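/- Let $H$ be a complete Heyting algebra (a set). A presheaf on $H$ is a functor $P:H^{op}\to\mathbf{Set}$; write $x|_k$ for the restriction of $x\in P(h)$ to $k\le h$. It is a sheaf if for every $A\subseteq H$ and every family $\langle x_k\in P(k)\rangle_{k\in A}$ with $x_k|_{k\wedge l}=x_l|_{k\wedge l}$ for all $k,l\in A$ there is a unique $x\in P(\bigvee A)$ with $x|_k=x_k$ for all $k\in A$. $\mathbf{SHV}(H)$ is the full subcategory of sheaves in $\mathbf{Set}^{H^{op}}$. Let $PT_{\inf}(H)$ have sets as objects and, as morphisms $\tau:A\to B$, families of relations $\tau_h\subseteq B\times A$ ($h\in H$) such that for all $a\in A$, $b\in B$ the set $\{h\mid \tau_h(b,a)\}$ is of the form $\{h\mid h\le m\}$. The composite of $\tau:A\to B$ and $\sigma:B\to C$ is given by: $(\sigma\tau)_h(c,a)$ iff there is a (possibly empty) family $\langle k_i,l_i\rangle_{i\in I}$ in $H$ with $h\le\bigvee_i(k_i\wedge l_i)$ and, for every $i$, some $b\in B$ with $\sigma_{k_i}(c,b)$ and $\tau_{l_i}(b,a)$. Morphisms are ordered by inclusion of all relations, and the involution $\tau^*$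 takes the inverse of each relation. For an involutive order-enriched semicategory $\mathcal O$, $\mathbf{Kar}^*(\mathcal O)$ is the category whose objects are the symmetric idempotents ($f^*=f=ff$) of $\mathcal O$ and whose morphisms $f\to g$ are the arrows $\varphi$ with $\varphi f=\varphi=g\varphi$, the identity of $f$ being $f$ itself. For an involutive order-enriched category $\mathcal C$, $\mathbf{Map}^*(\mathcal C)$ has the same objects, and the morphisms $f:A\to B$ with $1_A\le f^*f$ and $ff^*\le 1_B$. The category of relational-sheaves of $H$ is $\mathbf{Rel}^{H^{co}}_{\inf}=\mathbf{Map}^*(\mathbf{Kar}^*(PT_{\inf}(H)))$. For a relational-sheaf $F$ write $F(*)$ for its underlying set and $F(h)$ for its relations. For $h\in H$ let $F_h$ be the relational-sheaf on a one-point set $\{*\}$ with $F_h(k)(*,*)$ iff $k\le h$; for $k\le h$ let $F_k\to F_h$ be the morphism whose $l$-th relation holds iff $l\le k$. Define $\Theta_{\inf}:\mathbf{Rel}^{H^{co}}_{\inf}\to\mathbf{Set}^{H^{op}}$ by letting $\Theta_{\inf}(F)(h)$ be the set of morphisms $F_h\to F$, with restriction given by precomposition with $F_k\to F_h$, and letting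 $\Theta_{\inf}$ act on morphisms by postcomposition. Define $\Delta_{\inf}:\mathbf{Set}^{H^{op}}\to\mathbf{Rel}^{H^{co}}_{\inf}$ by $\Delta_{\inf}(P)(*)=\coprod_{h}P(h)$ and, for $b\in P(l)$, $a\in P(k)$, $$\Delta_{\inf}(P)(h)(b,a)\iff h\le\bigvee\{m\mid m\le k\wedge l,\ b|_m=a|_m\},$$ and, for $\tau:P\to Q$, $b\in Q(l)$, $a\in P(k)$, $$\Delta_{\inf}(\tau)_h(b,a)\iff h\le\bigvee\{m\mid m\le k\wedge l,\ b|_m=\tau_k(a)|_m\}.$$ Theorem. There is an adjunction $\Delta_{\inf}\dashv\Theta_{\inf}$ whose unit $\eta$ sends $x\in P(h)$ to the morphism $\alpha^x:F_h\to\Delta_{\inf}(P)$ with $\alpha^x_l(y,*)$ iff $\Delta_{\inf}(P)(l)(y,x)$. For every relational-sheaf $F$ the morphism $\eta_{\Theta_{\inf}(F)}$ is an isomorphism and $\Theta_{\inf}(F)$ is a sheaf. Moreover the restriction of $\Delta_{\inf}$ to sheaves and the corestriction of $\Theta_{\inf}$ to sheaves are the two functors of an equivalence of categories $$\mathbf{SHV}(H)\simeq\mathbf{Rel}^{H^{co}}_{\inf}.$$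 -/

import Mathlib

open CategoryTheory Opposite

universe u v

namespace RelSheaf

/-! ### Presheaves and sheaves on a complete Heyting algebra -/

section Sheaves

variable {H : Type u} [Order.Frame H]

/-- The restriction `x|_k` of a section `x ∈ P(h)` along `k ≤ h`. -/
def res (P : Hᵒᵖ ⥤ Type u) {k h : H} (hk : k ≤ h) (x : P.obj (op h)) : P.obj (op k) :=
  P.map (homOfLE hk).op x

/-- `⟨x_k⟩_{k ∈ A}` is a matching family for the subset `A`. -/
def IsMatchingFamily (P : Hᵒᵖ ⥤ Type u) (A : Set H) (x : ∀ k : A, P.obj (op (k : H))) : Prop :=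
  ∀ k l : A, res P (inf_le_left : (k : H) ⊓ l ≤ k) (x k) =
    res P (inf_le_right : (k : H) ⊓ l ≤ l) (x l)

/-- `y ∈ P(⋁ A)` is an amalgamation of the family `⟨x_k⟩_{k ∈ A}`. -/
def IsAmalgamation (P : Hᵒᵖ ⥤ Type u) (A : Set H) (x : ∀ k : A, P.obj (op (k : H)))
    (y : P.obj (op (sSup A))) : Prop :=
  ∀ k : A, res P (le_sSup k.2) y = x k

/-- A presheaf is a sheaf if every matching family has a unique amalgamation. -/
def IsSheaf : ObjectProperty (Hᵒᵖ ⥤ Type u) := fun P =>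
  ∀ (A : Set H) (x : ∀ k : A, P.obj (op (k : H))), IsMatchingFamily P A x →
    ∃! y : P.obj (op (sSup A)), IsAmalgamation P A x y

variable (H) in
/-- The full subcategory of sheaves in the category of presheaves on `H`. -/
abbrev SHV := (IsSheaf (H := H)).FullSubcategory

end Sheaves

/-! ### Involutive order-enriched (semi)categories, `Kar*` and `Map*` -/

/-- Involutive order-enriched semicategories. Composition is written in diagrammatic order:
`comp f g` is `g ∘ f`. -/
class InvOrdSemicategory (O : Type u) where
  Hom : O → O → Type v
  order : ∀ A B : O, PartialOrder (Hom A B)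
  comp : ∀ {A B C : O}, Hom A B → Hom B C → Hom A C
  star : ∀ {A B : O}, Hom A B → Hom B A
  assoc : ∀ {A B C D : O} (f : Hom A B) (g : Hom B C) (h : Hom C D),
    comp (comp f g) h = comp f (comp g h)
  comp_le_comp : ∀ {A B C : O} {f f' : Hom A B} {g g' : Hom B C},
    f ≤ f' → g ≤ g' → comp f g ≤ comp f' g'
  star_star : ∀ {A B : O} (f : Hom A B), star (star f) = f
  star_comp : ∀ {A B C : O} (f : Hom A B) (g : Hom B C),
    star (comp f g) = comp (star g) (star f)
  star_le_star : ∀ {A B : O} {f f' : Hom A B}, f ≤ f' → star f ≤ star f'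

attribute [reducible, instance] InvOrdSemicategory.order

/-- Involutive order-enriched categories. -/
class InvOrdCategory (C : Type u) [Category.{v} C] where
  order : ∀ A B : C, PartialOrder (A ⟶ B)
  star : ∀ {A B : C}, (A ⟶ B) → (B ⟶ A)
  comp_le_comp : ∀ {X Y Z : C} {f f' : X ⟶ Y} {g g' : Y ⟶ Z},
    f ≤ f' → g ≤ g' → f ≫ g ≤ f' ≫ g'
  star_star : ∀ {A B : C} (f : A ⟶ B), star (star f) = f
  star_id : ∀ A : C, star (𝟙 A) = 𝟙 A
  star_comp : ∀ {X Y Z : C} (f : X ⟶ Y) (g : Y ⟶ Z), star (f ≫ g) = star g ≫ star f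
  star_le_star : ∀ {A B : C} {f f' : A ⟶ B}, f ≤ f' → star f ≤ star f'

attribute [reducible, instance] InvOrdCategory.order

section Kar

open InvOrdSemicategory

variable (O : Type u) [InvOrdSemicategory.{u, v} O]

/-- Objects of the symmetric Karoubian envelope: symmetric idempotents. -/
structure KarStar where
  pt : O
  arr : Hom pt pt
  symm : star arr = arr
  idem : comp arr arr = arr

variable {O}

/-- Morphisms `φ : f → g` of the symmetric Karoubian envelope: `φ ∘ f = φ = g ∘ φ`. -/
@[ext]
structure KarStar.Mor (f g : KarStar O) where
  arr : Hom f.pt g.pt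
  left : comp f.arr arr = arr
  right : comp arr g.arr = arr

instance : Category.{v} (KarStar O) where
  Hom f g := KarStar.Mor f g
  id f := ⟨f.arr, f.idem, f.idem⟩
  comp φ ψ := ⟨comp φ.arr ψ.arr, by rw [← assoc, φ.left], by rw [assoc, ψ.right]⟩
  id_comp φ := KarStar.Mor.ext φ.left
  comp_id φ := KarStar.Mor.ext φ.right
  assoc φ ψ χ := KarStar.Mor.ext (assoc φ.arr ψ.arr χ.arr)

instance : InvOrdCategory (KarStar O) where
  order f g := PartialOrder.lift (fun φ : KarStar.Mor f g => φ.arr)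
    (fun _ _ h => KarStar.Mor.ext h)
  star {f g} φ := ⟨star φ.arr,
    by have h := congrArg InvOrdSemicategory.star φ.right; rwa [star_comp, g.symm] at h,
    by have h := congrArg InvOrdSemicategory.star φ.left; rwa [star_comp, f.symm] at h⟩
  comp_le_comp h h' := InvOrdSemicategory.comp_le_comp h h'
  star_star φ := KarStar.Mor.ext (star_star φ.arr)
  star_id f := KarStar.Mor.ext f.symm
  star_comp φ ψ := KarStar.Mor.ext (star_comp φ.arr ψ.arr)
  star_le_star h := InvOrdSemicategory.star_le_star h

end Kar

section Map

open InvOrdCategory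

variable (C : Type u) [Category.{v} C] [InvOrdCategory C]

/-- Symmetric maps: `1 ≤ f* ∘ f` and `f ∘ f* ≤ 1`. -/
def symmetricMaps : MorphismProperty C := fun A B f =>
  𝟙 A ≤ f ≫ star f ∧ star f ≫ f ≤ 𝟙 B

instance : (symmetricMaps C).IsMultiplicative where
  id_mem A := by
    constructor <;> simp [star_id]
  comp_mem {X Y Z} f g hf hg := by
    constructor
    · calc 𝟙 X ≤ f ≫ star f := hf.1
        _ = (f ≫ 𝟙 Y) ≫ star f := by rw [Category.comp_id]
        _ ≤ (f ≫ (g ≫ star g)) ≫ star f :=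
          comp_le_comp (comp_le_comp le_rfl hg.1) le_rfl
        _ = (f ≫ g) ≫ star (f ≫ g) := by rw [star_comp]; simp only [Category.assoc]
    · calc star (f ≫ g) ≫ f ≫ g = (star g ≫ (star f ≫ f)) ≫ g := by
            rw [star_comp]; simp only [Category.assoc]
        _ ≤ (star g ≫ 𝟙 Y) ≫ g := comp_le_comp (comp_le_comp le_rfl hf.2) le_rfl
        _ = star g ≫ g := by rw [Category.comp_id]
        _ ≤ 𝟙 Z := hg.2

/-- The category with all objects of `C` and the symmetric maps as morphisms. -/
abbrev MapStar := WideSubcategory (symmetricMaps C)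

end Map

/-! ### Infima-preserving pre-transformations -/

section PT

variable (H : Type u) [Order.Frame H]

/-- Objects of the semicategory of infima-preserving pre-transformations: sets. -/
structure PTinf (H : Type u) where
  carrier : Type u

variable {H}

/-- An infima-preserving pre-transformation `A → B`: a family of relations `rel h ⊆ B × A` such
that every set `{h | rel h b a}` is a principal down-closed subset of `H`. -/
@[ext]
structure PreTrans (H : Type u) [Order.Frame H] (A B : Type u) where
  rel : H → B → A → Prop
  principal : ∀ b a, ∃ m : H, {h | rel h b a} = Set.Iic m

namespace PreTrans

variable {A B C D : Type u}

/-- The generator of the principal down-closed set `{h | rel h b a}`. -/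
def val (τ : PreTrans H A B) (b : B) (a : A) : H := sSup {h | τ.rel h b a}

theorem rel_iff (τ : PreTrans H A B) (h : H) (b : B) (a : A) :
    τ.rel h b a ↔ h ≤ τ.val b a := by
  obtain ⟨m, hm⟩ := τ.principal b a
  have h1 : τ.val b a = m := by rw [val, hm]; exact csSup_Iic
  rw [h1]
  exact Set.ext_iff.1 hm h

theorem ext_val {σ τ : PreTrans H A B} (h : ∀ b a, σ.val b a = τ.val b a) : σ = τ := by
  ext k b a
  rw [rel_iff, rel_iff, h]

/-- The pre-transformation of a matrix with entries in `H`. -/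
def ofMatrix (M : B → A → H) : PreTrans H A B where
  rel h b a := h ≤ M b a
  principal b a := ⟨M b a, rfl⟩

@[simp]
theorem val_ofMatrix (M : B → A → H) (b : B) (a : A) :
    (ofMatrix M : PreTrans H A B).val b a = M b a :=
  csSup_Iic

/-- The relation of the composite `σ ∘ τ` of infima-preserving pre-transformations. -/
def compRel (τ : PreTrans H A B) (σ : PreTrans H B C) (h : H) (c : C) (a : A) : Prop :=
  ∃ (I : Type u) (k l : I → H), h ≤ ⨆ i, k i ⊓ l i ∧
    ∀ i, ∃ b, σ.rel (k i) c b ∧ τ.rel (l i) b a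

theorem compRel_iff (τ : PreTrans H A B) (σ : PreTrans H B C) (h : H) (c : C) (a : A) :
    compRel τ σ h c a ↔ h ≤ ⨆ b, σ.val c b ⊓ τ.val b a := by
  constructor
  · rintro ⟨I, k, l, hh, hi⟩
    refine hh.trans (iSup_le fun i => ?_)
    obtain ⟨b, h1, h2⟩ := hi i
    exact (inf_le_inf ((rel_iff _ _ _ _).1 h1) ((rel_iff _ _ _ _).1 h2)).trans
      (le_iSup (fun b => σ.val c b ⊓ τ.val b a) b)
  · intro hh
    exact ⟨B, fun b => σ.val c b, fun b => τ.val b a, hh,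
      fun b => ⟨b, (rel_iff _ _ _ _).2 le_rfl, (rel_iff _ _ _ _).2 le_rfl⟩⟩

/-- The composite `σ ∘ τ`. -/
def comp (τ : PreTrans H A B) (σ : PreTrans H B C) : PreTrans H A C where
  rel := compRel τ σ
  principal c a := ⟨⨆ b, σ.val c b ⊓ τ.val b a, Set.ext fun h => compRel_iff τ σ h c a⟩

@[simp]
theorem val_comp (τ : PreTrans H A B) (σ : PreTrans H B C) (c : C) (a : A) :
    (τ.comp σ).val c a = ⨆ b, σ.val c b ⊓ τ.val b a := by
  refine eq_of_forall_le_iff fun h => ?_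
  rw [← rel_iff, ← compRel_iff]
  rfl

/-- The involution takes the inverse of every relation of the family. -/
def star (τ : PreTrans H A B) : PreTrans H B A where
  rel h a b := τ.rel h b a
  principal a b := τ.principal b a

@[simp]
theorem val_star (τ : PreTrans H A B) (b : B) (a : A) : τ.star.val a b = τ.val b a := rfl

instance : PartialOrder (PreTrans H A B) :=
  PartialOrder.lift PreTrans.rel fun _ _ h => PreTrans.ext h

theorem le_iff_val {σ τ : PreTrans H A B} : σ ≤ τ ↔ ∀ b a, σ.val b a ≤ τ.val b a := by
  constructor
  · intro h b a
    exact (rel_iff _ _ _ _).1 (h _ _ _ ((rel_iff _ _ _ _).2 le_rfl))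
  · intro h k b a hk
    exact (rel_iff _ _ _ _).2 (((rel_iff _ _ _ _).1 hk).trans (h b a))

theorem comp_assoc (τ : PreTrans H A B) (σ : PreTrans H B C) (ρ : PreTrans H C D) :
    (τ.comp σ).comp ρ = τ.comp (σ.comp ρ) := by
  refine ext_val fun d a => ?_
  simp only [val_comp, inf_iSup_eq, iSup_inf_eq]
  rw [iSup_comm]
  simp only [inf_assoc]

end PreTrans

instance : InvOrdSemicategory.{u + 1, u} (PTinf H) where
  Hom A B := PreTrans H A.carrier B.carrier
  order _ _ := inferInstance
  comp τ σ := τ.comp σ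
  star τ := τ.star
  assoc := PreTrans.comp_assoc
  comp_le_comp := by
    intro A B C f f' g g' hf hg
    rw [PreTrans.le_iff_val] at *
    intro c a
    simp only [PreTrans.val_comp]
    exact iSup_mono fun b => inf_le_inf (hg c b) (hf b a)
  star_star _ := rfl
  star_comp f g := by
    refine PreTrans.ext_val fun a c => ?_
    simp only [PreTrans.val_star, PreTrans.val_comp]
    exact iSup_congr fun b => inf_comm _ _
  star_le_star := fun h k a b => h k b a

variable (H) in
/-- The category of relational-sheaves of `H`: `Map*(Kar*(PT_inf(H)))`. -/
abbrev RelInf := MapStar (KarStar (PTinf H))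

end PT

/-! ### Relational-sheaves in components -/

section RelInf

variable {H : Type u} [Order.Frame H]

namespace RelInf

/-- The underlying set `F(*)` of a relational-sheaf. -/
def set (F : RelInf H) : Type u := F.obj.pt.carrier

/-- The family of relations `F(h)` of a relational-sheaf. -/
def fam (F : RelInf H) : PreTrans H F.set F.set := F.obj.arr

/-- The family of relations `τ_h` of a morphism of relational-sheaves. -/
def tr {F G : RelInf H} (τ : F ⟶ G) : PreTrans H F.set G.set := τ.hom.arr

theorem hom_ext {F G : RelInf H} {σ τ : F ⟶ G} (h : tr σ = tr τ) : σ = τ :=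
  WideSubcategory.hom_ext _ (KarStar.Mor.ext h)

/-- A relational-sheaf from a symmetric idempotent infima-preserving pre-transformation. -/
def mk (A : Type u) (τ : PreTrans H A A) (symm : τ.star = τ) (idem : τ.comp τ = τ) : RelInf H :=
  ⟨⟨⟨A⟩, τ, symm, idem⟩⟩

/-- A morphism of relational-sheaves from a pre-transformation with the required properties. -/
def homMk {F G : RelInf H} (τ : PreTrans H F.set G.set) (left : F.fam.comp τ = τ)
    (right : τ.comp G.fam = τ) (total : F.fam ≤ τ.comp τ.star)
    (single : τ.star.comp τ ≤ G.fam) : F ⟶ G :=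
  ⟨⟨τ, left, right⟩, total, single⟩

end RelInf

/-! ### The functor `Θ_inf` -/

/-- The pre-transformation on the one-point set whose `l`-th relation holds iff `l ≤ k`. -/
def singleArr (k : H) : PreTrans H PUnit PUnit := PreTrans.ofMatrix fun _ _ => k

theorem singleArr_comp (k l : H) : (singleArr k).comp (singleArr l) = singleArr (l ⊓ k) :=
  PreTrans.ext_val fun _ _ => by simp [singleArr]

theorem singleArr_le {k l : H} (h : k ≤ l) : singleArr k ≤ singleArr l :=
  PreTrans.le_iff_val.2 fun _ _ => by simpa [singleArr] using h

/-- The singleton relational-sheaf `F_h`: one point, with `F_h(k)(*,*) = 1` iff `k ≤ h`. -/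
def single (h : H) : RelInf H :=
  RelInf.mk PUnit (singleArr h) rfl (by rw [singleArr_comp, inf_idem])

/-- For `k ≤ h` the singleton morphism `F_k → F_h` with `l`-th relation holding iff `l ≤ k`. -/
def singleMap {k h : H} (hk : k ≤ h) : single k ⟶ single h :=
  RelInf.homMk (F := single k) (G := single h) (singleArr k)
    ((singleArr_comp k k).trans (by rw [inf_idem]))
    ((singleArr_comp k h).trans (by rw [inf_eq_right.2 hk]))
    (le_of_le_of_eq (singleArr_le (le_inf le_rfl le_rfl)) (singleArr_comp k k).symm)
    (le_of_eq_of_le (singleArr_comp k k) (singleArr_le (inf_le_left.trans hk)))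

theorem singleMap_refl (h : H) : singleMap (le_refl h) = 𝟙 (single h) := rfl

theorem singleMap_comp {k l h : H} (hk : k ≤ l) (hl : l ≤ h) :
    singleMap hk ≫ singleMap hl = singleMap (hk.trans hl) :=
  RelInf.hom_ext ((singleArr_comp k l).trans (by rw [inf_eq_right.2 hk]; rfl))

/-- The presheaf `Θ_inf(F)` of singleton morphisms `F_h → F`, with restriction along `k ≤ h`
given by precomposition with `F_k → F_h`. -/
def ThetaObj (F : RelInf H) : Hᵒᵖ ⥤ Type u where
  obj h := single h.unop ⟶ F
  map f := TypeCat.ofHom fun α => singleMap (leOfHom f.unop) ≫ α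
  map_id h := by
    refine ConcreteCategory.hom_ext _ _ fun α => ?_
    exact Category.id_comp α
  map_comp f g := by
    refine ConcreteCategory.hom_ext _ _ fun α => ?_
    change singleMap _ ≫ α = singleMap _ ≫ singleMap _ ≫ α
    rw [← Category.assoc, singleMap_comp]

variable (H) in
/-- `Θ_inf`, acting on morphisms by postcomposition. -/
def Theta : RelInf H ⥤ (Hᵒᵖ ⥤ Type u) where
  obj := ThetaObj
  map τ :=
    { app := fun _ => TypeCat.ofHom fun α => α ≫ τ
      naturality := by
        intro _ _ f
        ext α
        exact (Category.assoc _ _ _) }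
  map_id F := by
    ext h α
    exact Category.comp_id α
  map_comp σ τ := by
    ext h α
    exact (Category.assoc _ _ _).symm

/-! ### The functor `Δ_inf` -/

/-- The supremum of all `m ≤ k ∧ l` such that `b ∈ P(l)` and `a ∈ P(k)` have the same restriction
to `m`. -/
def agree (P : Hᵒᵖ ⥤ Type u) (b a : Σ h : H, P.obj (op h)) : H :=
  sSup {m | ∃ (hb : m ≤ b.1) (ha : m ≤ a.1), res P hb b.2 = res P ha a.2}

/-- The action of a transformation of presheaves on `∐_h P(h)`. -/
def sigmaMap {P Q : Hᵒᵖ ⥤ Type u} (τ : P ⟶ Q) (a : Σ h : H, P.obj (op h)) :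
    Σ h : H, Q.obj (op h) :=
  ⟨a.1, τ.app (op a.1) a.2⟩

theorem res_res (P : Hᵒᵖ ⥤ Type u) {m k h : H} (hm : m ≤ k) (hk : k ≤ h) (x : P.obj (op h)) :
    res P hm (res P hk x) = res P (hm.trans hk) x := by
  simp only [res]
  rw [← Functor.map_comp_apply]
  rfl

theorem res_app {P Q : Hᵒᵖ ⥤ Type u} (τ : P ⟶ Q) {k h : H} (hk : k ≤ h) (x : P.obj (op h)) :
    res Q hk (τ.app (op h) x) = τ.app (op k) (res P hk x) :=
  (NatTrans.naturality_apply τ (homOfLE hk).op x).symm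

theorem agree_comm (P : Hᵒᵖ ⥤ Type u) (b a : Σ h : H, P.obj (op h)) :
    agree P b a = agree P a b := by
  unfold agree
  congr 1
  ext m
  exact ⟨fun ⟨hb, ha, h⟩ => ⟨ha, hb, h.symm⟩, fun ⟨hb, ha, h⟩ => ⟨ha, hb, h.symm⟩⟩

theorem agree_le_left (P : Hᵒᵖ ⥤ Type u) (b a : Σ h : H, P.obj (op h)) : agree P b a ≤ b.1 :=
  sSup_le fun _ ⟨hb, _, _⟩ => hb

theorem agree_self (P : Hᵒᵖ ⥤ Type u) (a : Σ h : H, P.obj (op h)) : agree P a a = a.1 :=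
  le_antisymm (agree_le_left P a a) (le_sSup ⟨le_rfl, le_rfl, rfl⟩)

theorem agree_trans (P : Hᵒᵖ ⥤ Type u) (c b a : Σ h : H, P.obj (op h)) :
    agree P c b ⊓ agree P b a ≤ agree P c a := by
  unfold agree
  rw [sSup_inf_sSup]
  refine iSup₂_le ?_
  rintro ⟨m, n⟩ ⟨⟨hc, hb, h1⟩, ⟨hb', ha, h2⟩⟩
  refine le_sSup ⟨inf_le_left.trans hc, inf_le_right.trans ha, ?_⟩
  have e1 := congrArg (res P (inf_le_left : m ⊓ n ≤ m)) h1
  have e2 := congrArg (res P (inf_le_right : m ⊓ n ≤ n)) h2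
  simp only [res_res] at e1 e2
  exact e1.trans e2

theorem agree_sigmaMap {P Q : Hᵒᵖ ⥤ Type u} (τ : P ⟶ Q) (b a : Σ h : H, P.obj (op h)) :
    agree P b a ≤ agree Q (sigmaMap τ b) (sigmaMap τ a) := by
  refine sSup_le_sSup ?_
  rintro m ⟨hb, ha, h⟩
  exact ⟨hb, ha, by simp only [sigmaMap, res_app]; rw [h]⟩

/-- The pre-transformation `∐_h P(h) → ∐_h Q(h)` of a transformation `τ : P → Q`: its `h`-th
relation holds at `(b, a)` iff `h` is below the supremum of all `m` on which the restrictions of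
`b` and `τ(a)` are defined and equal. -/
def deltaArr {P Q : Hᵒᵖ ⥤ Type u} (τ : P ⟶ Q) :
    PreTrans H (Σ h : H, P.obj (op h)) (Σ h : H, Q.obj (op h)) :=
  PreTrans.ofMatrix fun b a => agree Q b (sigmaMap τ a)

/-- The pre-transformation `h ≤ ⋁ {m | b|_m = a|_m}` on `∐_h P(h)`. -/
def deltaIdem (P : Hᵒᵖ ⥤ Type u) :
    PreTrans H (Σ h : H, P.obj (op h)) (Σ h : H, P.obj (op h)) :=
  PreTrans.ofMatrix (agree P)

theorem deltaArr_id (P : Hᵒᵖ ⥤ Type u) : deltaArr (𝟙 P) = deltaIdem P := rfl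

theorem deltaArr_comp {P Q R : Hᵒᵖ ⥤ Type u} (τ : P ⟶ Q) (σ : Q ⟶ R) :
    (deltaArr τ).comp (deltaArr σ) = deltaArr (τ ≫ σ) := by
  refine PreTrans.ext_val fun c a => ?_
  simp only [deltaArr, PreTrans.val_comp, PreTrans.val_ofMatrix]
  refine le_antisymm (iSup_le fun b => ?_) ?_
  · exact (inf_le_inf le_rfl (agree_sigmaMap σ _ _)).trans (agree_trans R _ _ _)
  · refine le_trans ?_ (le_iSup (fun b => agree R c (sigmaMap σ b) ⊓
      agree Q b (sigmaMap τ a)) (sigmaMap τ a))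
    refine le_inf le_rfl ?_
    rw [agree_self, agree_comm]
    exact agree_le_left R _ _

theorem deltaIdem_star (P : Hᵒᵖ ⥤ Type u) : (deltaIdem P).star = deltaIdem P :=
  PreTrans.ext_val fun a b => by simp [deltaIdem, agree_comm P a b]

theorem deltaIdem_comp (P : Hᵒᵖ ⥤ Type u) : (deltaIdem P).comp (deltaIdem P) = deltaIdem P := by
  rw [← deltaArr_id, deltaArr_comp, Category.comp_id]

theorem deltaIdem_le {P Q : Hᵒᵖ ⥤ Type u} (τ : P ⟶ Q) :
    deltaIdem P ≤ (deltaArr τ).comp (deltaArr τ).star := by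
  refine PreTrans.le_iff_val.2 fun c a => ?_
  simp only [deltaIdem, deltaArr, PreTrans.val_comp, PreTrans.val_ofMatrix, PreTrans.val_star]
  refine le_trans ?_ (le_iSup
    (fun b => agree Q b (sigmaMap τ c) ⊓ agree Q b (sigmaMap τ a)) (sigmaMap τ c))
  refine le_inf ?_ (agree_sigmaMap τ c a)
  rw [agree_self]
  exact agree_le_left P c a

theorem le_deltaIdem {P Q : Hᵒᵖ ⥤ Type u} (τ : P ⟶ Q) :
    (deltaArr τ).star.comp (deltaArr τ) ≤ deltaIdem Q := by
  refine PreTrans.le_iff_val.2 fun c a => ?_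
  simp only [deltaIdem, deltaArr, PreTrans.val_comp, PreTrans.val_ofMatrix, PreTrans.val_star]
  refine iSup_le fun b => ?_
  rw [agree_comm Q a]
  exact agree_trans Q _ _ _

/-- The relational-sheaf `Δ_inf(P)` on the set `∐_h P(h)`. -/
def DeltaObj (P : Hᵒᵖ ⥤ Type u) : RelInf H :=
  RelInf.mk (Σ h : H, P.obj (op h)) (deltaIdem P) (deltaIdem_star P) (deltaIdem_comp P)

variable (H) in
/-- `Δ_inf`. -/
def Delta : (Hᵒᵖ ⥤ Type u) ⥤ RelInf H where
  obj := DeltaObj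
  map {P Q} τ := RelInf.homMk (F := DeltaObj P) (G := DeltaObj Q) (deltaArr τ)
    ((deltaArr_comp (𝟙 P) τ).trans (by rw [Category.id_comp]))
    ((deltaArr_comp τ (𝟙 Q)).trans (by rw [Category.comp_id]))
    (deltaIdem_le τ) (le_deltaIdem τ)
  map_id P := RelInf.hom_ext (deltaArr_id P)
  map_comp τ σ := RelInf.hom_ext (deltaArr_comp τ σ).symm

end RelInf

end RelSheaf

/-! A principal family of relations is a matrix with entries in `H`. So a relational-sheaf is a set
with a symmetric, transitive `H`-valued equality `F(a,b)`, where `F(a,a)` is the extent of `a`. A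
morphism is a total, single-valued matrix compatible with these equalities. Between such maps the
order is discrete (`hom_ext_le`), so each equation between morphisms needs only one inequality; for
a composite, often one well-chosen term of the supremum suffices.

A morphism `F_h → F` amounts to a vector `v` with supremum `h` satisfying `F(a,b) ∧ v(b) ≤ v(a)` and
`v(a) ∧ v(b) ≤ F(a,b)`, and restriction to `k` is meet with `k`. Matching vectors glue by pointwise
suprema, so `Θ(F)` is a sheaf.

The counit is the evaluation matrix `(a, s) ↦ s(a)`. Its transpose is again a map: each `a` is
covered by the column `F(-,a)`, and two sections agree wherever they share a value. Hence the counit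
is invertible, and a triangle identity makes the unit invertible at every `Θ(F)`.

For a sheaf `P` the unit is bijective: separatedness gives injectivity, and a vector on the sections
of `P` is recovered by cutting each section `y` down to `v(y)` and gluing. The adjunction therefore
restricts to an equivalence. -/

namespace RelSheaf

variable {H : Type u} [Order.Frame H]

/-! ### Relational-sheaves as `H`-valued equalities, morphisms as matrices. -/

namespace RelInf

variable {F G K : RelInf H}

theorem val_fam_comm (F : RelInf H) (a b : F.set) : F.fam.val a b = F.fam.val b a :=
  congrArg (fun τ : PreTrans H F.set F.set => τ.val b a) F.obj.symm

theorem val_fam_trans (F : RelInf H) (c b a : F.set) :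
    F.fam.val c b ⊓ F.fam.val b a ≤ F.fam.val c a := by
  have h : F.fam.comp F.fam = F.fam := F.obj.idem
  conv_rhs => rw [← h, PreTrans.val_comp]
  exact le_iSup (fun b => F.fam.val c b ⊓ F.fam.val b a) b

theorem val_fam_le_right (F : RelInf H) (b a : F.set) : F.fam.val b a ≤ F.fam.val a a :=
  (le_inf (val_fam_comm F b a).le le_rfl).trans (val_fam_trans F a b a)

theorem val_tr_comp (τ : F ⟶ G) (σ : G ⟶ K) (c : K.set) (a : F.set) :
    (tr (τ ≫ σ)).val c a = ⨆ b, (tr σ).val c b ⊓ (tr τ).val b a :=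
  PreTrans.val_comp _ _ _ _

theorem le_val_tr_comp (τ : F ⟶ G) (σ : G ⟶ K) (c : K.set) (b : G.set) (a : F.set) :
    (tr σ).val c b ⊓ (tr τ).val b a ≤ (tr (τ ≫ σ)).val c a :=
  (le_iSup (fun b => (tr σ).val c b ⊓ (tr τ).val b a) b).trans (val_tr_comp τ σ c a).ge

theorem val_fam_inf_tr_le (τ : F ⟶ G) (b b' : G.set) (a : F.set) :
    G.fam.val b b' ⊓ (tr τ).val b' a ≤ (tr τ).val b a := by
  have h : (tr τ).comp G.fam = tr τ := τ.hom.right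
  conv_rhs => rw [← h, PreTrans.val_comp]
  exact le_iSup (fun b' => G.fam.val b b' ⊓ (tr τ).val b' a) b'

theorem val_tr_le_fam (τ : F ⟶ G) (b : G.set) (a : F.set) :
    (tr τ).val b a ≤ F.fam.val a a := by
  have h : F.fam.comp (tr τ) = tr τ := τ.hom.left
  conv_lhs => rw [← h, PreTrans.val_comp]
  exact iSup_le fun a' => inf_le_right.trans (val_fam_le_right F a' a)

theorem val_tr_inf_tr_le (τ : F ⟶ G) (b b' : G.set) (a : F.set) :
    (tr τ).val b a ⊓ (tr τ).val b' a ≤ G.fam.val b b' := by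
  have h : (tr τ).star.comp (tr τ) ≤ G.fam := τ.property.2
  refine le_trans ?_ (PreTrans.le_iff_val.1 h b b')
  rw [PreTrans.val_comp]
  exact le_iSup (fun a => (tr τ).val b a ⊓ (tr τ).val b' a) a

theorem fam_le_iSup_tr (τ : F ⟶ G) (a : F.set) : F.fam.val a a ≤ ⨆ b, (tr τ).val b a := by
  have h : F.fam ≤ (tr τ).comp (tr τ).star := τ.property.1
  refine (PreTrans.le_iff_val.1 h a a).trans ?_
  rw [PreTrans.val_comp]
  exact iSup_mono fun b => inf_le_right

/-- A morphism of relational-sheaves from a matrix that is extensional in both arguments, strict,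
total and single-valued. -/
def ofMatrix (M : G.set → F.set → H) (ext_left : ∀ b a' a, M b a' ⊓ F.fam.val a' a ≤ M b a)
    (ext_right : ∀ b b' a, G.fam.val b b' ⊓ M b' a ≤ M b a)
    (strict : ∀ b a, M b a ≤ F.fam.val a a) (total : ∀ a, F.fam.val a a ≤ ⨆ b, M b a)
    (single : ∀ b b' a, M b a ⊓ M b' a ≤ G.fam.val b b') : F ⟶ G :=
  homMk (PreTrans.ofMatrix M)
    (PreTrans.ext_val fun b a => by
      simp only [PreTrans.val_comp, PreTrans.val_ofMatrix]
      exact le_antisymm (iSup_le fun a' => ext_left b a' a)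
        (le_iSup_of_le a (le_inf le_rfl (strict b a))))
    (PreTrans.ext_val fun b a => by
      simp only [PreTrans.val_comp, PreTrans.val_ofMatrix]
      exact le_antisymm (iSup_le fun b' => ext_right b b' a)
        (le_iSup_of_le b (le_inf ((le_inf le_rfl le_rfl).trans (single b b a)) le_rfl)))
    (PreTrans.le_iff_val.2 fun a' a => by
      simp only [PreTrans.val_comp, PreTrans.val_ofMatrix, PreTrans.val_star]
      -- Since `F(a',a)` lies below the extent of `a`, totality covers it by the entries `M b a`;
      -- extensionality then moves each of them to `M b a'`.
      refine (le_inf ((val_fam_le_right F a' a).trans (total a)) le_rfl).trans ?_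
      rw [iSup_inf_eq]
      refine iSup_mono fun b => le_inf ?_ inf_le_left
      rw [val_fam_comm F a' a]
      exact ext_left b a a')
    (PreTrans.le_iff_val.2 fun b b' => by
      simp only [PreTrans.val_comp, PreTrans.val_ofMatrix, PreTrans.val_star]
      exact iSup_le fun a => single b b' a)

@[simp]
theorem val_tr_ofMatrix (M : G.set → F.set → H) (h₁ h₂ h₃ h₄ h₅) (b : G.set) (a : F.set) :
    (tr (ofMatrix M h₁ h₂ h₃ h₄ h₅ : F ⟶ G)).val b a = M b a :=
  PreTrans.val_ofMatrix M b a

theorem hom_ext_val {σ τ : F ⟶ G} (h : ∀ b a, (tr σ).val b a = (tr τ).val b a) : σ = τ :=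
  hom_ext (PreTrans.ext_val h)

/-- The order on morphisms of relational-sheaves is discrete. -/
theorem hom_ext_le {σ τ : F ⟶ G} (h : ∀ b a, (tr σ).val b a ≤ (tr τ).val b a) : σ = τ := by
  refine hom_ext_val fun b a => (h b a).antisymm ?_
  -- Totality of `σ` covers `τ(b,a)` by the entries `σ(b',a) ≤ τ(b',a)`. On each piece
  -- single-valuedness of `τ` identifies `b` with `b'`, so extensionality of `σ` gives `σ(b,a)`.
  refine (le_inf ((val_tr_le_fam τ b a).trans (fam_le_iSup_tr σ a)) le_rfl).trans ?_
  rw [iSup_inf_eq]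
  refine iSup_le fun b' => (le_inf ?_ inf_le_left).trans (val_fam_inf_tr_le σ b b' a)
  rw [inf_comm]
  exact (inf_le_inf le_rfl (h b' a)).trans (val_tr_inf_tr_le τ b b' a)

/-! ### Morphisms `F_h → F` as vectors. -/

/-- The value at `a` of a morphism `F_h → F`. -/
def entry {h : H} (s : single h ⟶ F) (a : F.set) : H := (tr s).val a PUnit.unit

theorem val_fam_single (h : H) (x y : (single h).set) : (single h).fam.val x y = h :=
  PreTrans.val_ofMatrix (A := PUnit) (B := PUnit) _ x y

theorem entry_le {h : H} (s : single h ⟶ F) (a : F.set) : entry s a ≤ h :=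
  (val_tr_le_fam s a _).trans_eq (val_fam_single h _ _)

theorem entry_inf_entry_le {h : H} (s : single h ⟶ F) (a b : F.set) :
    entry s a ⊓ entry s b ≤ F.fam.val a b :=
  val_tr_inf_tr_le s a b _

theorem entry_le_fam {h : H} (s : single h ⟶ F) (a : F.set) : entry s a ≤ F.fam.val a a :=
  (le_inf le_rfl le_rfl).trans (entry_inf_entry_le s a a)

theorem fam_inf_entry_le {h : H} (s : single h ⟶ F) (a b : F.set) :
    F.fam.val a b ⊓ entry s b ≤ entry s a :=
  val_fam_inf_tr_le s a b _

theorem le_iSup_entry {h : H} (s : single h ⟶ F) : h ≤ ⨆ a, entry s a :=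
  (val_fam_single h _ _).ge.trans (fam_le_iSup_tr s PUnit.unit)

theorem single_hom_ext_le {h : H} {s t : single h ⟶ F} (e : ∀ a, entry s a ≤ entry t a) : s = t :=
  hom_ext_le fun b _ => e b

/-- A morphism `F_h → F` from a vector with entries in `H`. -/
def singleHom (h : H) (v : F.set → H) (le : ∀ a, v a ≤ h)
    (ext : ∀ a b, F.fam.val a b ⊓ v b ≤ v a) (total : h ≤ ⨆ a, v a)
    (inf_le : ∀ a b, v a ⊓ v b ≤ F.fam.val a b) : single h ⟶ F :=
  ofMatrix (fun a _ => v a) (fun _ _ _ => inf_le_left) (fun a b _ => ext a b)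
    (fun a _ => (le a).trans_eq (val_fam_single h _ _).symm)
    (fun _ => (val_fam_single h _ _).le.trans total) (fun a b _ => inf_le a b)

@[simp]
theorem entry_singleHom (h : H) (v : F.set → H) (h₁ h₂ h₃ h₄) (a : F.set) :
    entry (singleHom h v h₁ h₂ h₃ h₄) a = v a :=
  val_tr_ofMatrix _ _ _ _ _ _ _ _

theorem entry_comp {h : H} (s : single h ⟶ F) (τ : F ⟶ G) (b : G.set) :
    entry (s ≫ τ) b = ⨆ a, (tr τ).val b a ⊓ entry s a :=
  val_tr_comp _ _ _ _

theorem entry_singleMap_comp {k h : H} (hk : k ≤ h) (s : single h ⟶ F) (a : F.set) :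
    entry (singleMap hk ≫ s) a = entry s a ⊓ k := by
  refine (val_tr_comp _ _ _ _).trans (le_antisymm (iSup_le fun x => ?_) ?_)
  · exact inf_le_inf le_rfl (PreTrans.val_ofMatrix (A := PUnit) (B := PUnit) _ _ _).le
  · exact le_iSup_of_le PUnit.unit
      (inf_le_inf le_rfl (PreTrans.val_ofMatrix (A := PUnit) (B := PUnit) (fun _ _ => k) _ _).ge)

end RelInf

open RelInf

/-! ### Gluing in `Θ_inf(F)`. -/

theorem res_Theta (F : RelInf H) {k h : H} (hk : k ≤ h) (s : single h ⟶ F) :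
    res ((Theta H).obj F) hk s = singleMap hk ≫ s := rfl

/-- The sheaf condition for `Θ_inf(F)`. -/
theorem isSheaf_Theta (F : RelInf H) : IsSheaf ((Theta H).obj F) := by
  intro A x hx
  change ∀ k : A, single (k : H) ⟶ F at x
  have hx' : ∀ (k l : A) (a : F.set), entry (x k) a ⊓ l ≤ entry (x l) a := by
    intro k l a
    have h := congrArg (fun s : single ((k : H) ⊓ l) ⟶ F => entry s a) (hx k l)
    simp only [res_Theta] at h
    erw [entry_singleMap_comp, entry_singleMap_comp] at h
    refine le_trans ?_ (h.le.trans inf_le_left)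
    exact le_inf inf_le_left (inf_le_inf (entry_le _ _) le_rfl)
  -- The amalgamation is the pointwise supremum. In its single-valuedness the cross terms `x_k(a) ∧
  -- x_l(b)` are handled by `x_l(b) ≤ l`, which turns `x_k(a)` into `x_l(a)`.
  let s : single (sSup A) ⟶ F := singleHom (sSup A) (fun a => ⨆ k : A, entry (x k) a)
    (fun a => iSup_le fun k => (entry_le _ _).trans (le_sSup k.2))
    (fun a b => by
      rw [inf_iSup_eq]
      exact iSup_mono fun k => fam_inf_entry_le (x k) a b)
    (sSup_le fun k hk => (le_iSup_entry (x ⟨k, hk⟩)).trans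
      (iSup_mono fun a => le_iSup (fun k : A => entry (x k) a) ⟨k, hk⟩))
    (fun a b => by
      rw [iSup_inf_iSup]
      refine iSup_le fun ⟨k, l⟩ => ?_
      refine le_trans (le_inf ?_ inf_le_right) (entry_inf_entry_le (x l) a b)
      exact (inf_le_inf le_rfl (entry_le _ _)).trans (hx' k l a))
  refine ⟨s, fun l => ?_, fun t ht => ?_⟩
  · refine (single_hom_ext_le fun a => ?_).symm
    erw [entry_singleMap_comp, entry_singleHom]
    exact le_inf (le_iSup (fun k : A => entry (x k) a) l) (entry_le _ _)
  · change single (sSup A) ⟶ F at t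
    refine (single_hom_ext_le fun a => ?_).symm
    erw [entry_singleHom]
    -- Any amalgamation `t` dominates `s`, because `x_k = t ∧ k` entrywise; discreteness of the
    -- order does the rest.
    refine iSup_le fun k => ?_
    rw [← ht k]
    erw [res_Theta, entry_singleMap_comp]
    exact inf_le_left

/-! ### Agreement of local sections. -/

/-- The set `∐_h P(h)` of all local sections of a presheaf. -/
abbrev Sections (P : Hᵒᵖ ⥤ Type u) : Type u := Σ h : H, P.obj (op h)

section Agree

variable (P : Hᵒᵖ ⥤ Type u)

theorem val_fam_Delta (y x : Sections P) :
    ((Delta H).obj P).fam.val y x = agree P y x :=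
  PreTrans.val_ofMatrix _ _ _

theorem agree_le_right (b a : Sections P) : agree P b a ≤ a.1 :=
  (agree_comm P b a).le.trans (agree_le_left P a b)

theorem agree_inf_agree_le (c b a : Sections P) :
    agree P b a ⊓ agree P c a ≤ agree P b c :=
  (inf_le_inf le_rfl (agree_comm P c a).le).trans (agree_trans P b a c)

theorem agree_res {m h : H} (hm : m ≤ h) (x : P.obj (op h)) :
    agree P ⟨m, res P hm x⟩ ⟨h, x⟩ = m :=
  le_antisymm (agree_le_left P _ _) (le_sSup ⟨le_rfl, hm, by rw [res_res]⟩)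

theorem agree_res_le {m h : H} (hm : m ≤ h) (x : P.obj (op h)) (y : Sections P) :
    agree P y ⟨m, res P hm x⟩ ≤ agree P y ⟨h, x⟩ :=
  (le_inf le_rfl ((agree_le_right P _ _).trans (agree_res P hm x).ge)).trans (agree_trans P _ _ _)

end Agree

/-! ### Unit and counit. -/

/-- The unit of the adjunction at `x ∈ P(h)`. -/
def unitHom (P : Hᵒᵖ ⥤ Type u) {h : H} (x : P.obj (op h)) : single h ⟶ (Delta H).obj P :=
  singleHom (F := (Delta H).obj P) h (fun y => agree P y ⟨h, x⟩)
    (fun y => agree_le_right P y ⟨h, x⟩)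
    (fun y z => (inf_le_inf (val_fam_Delta P y z).le le_rfl).trans (agree_trans P y z _))
    (le_iSup_of_le (ι := Sections P) ⟨h, x⟩ (agree_self P ⟨h, x⟩).ge)
    (fun y z => (agree_inf_agree_le P z y _).trans (val_fam_Delta P y z).ge)

theorem entry_unitHom (P : Hᵒᵖ ⥤ Type u) {h : H} (x : P.obj (op h)) (y : Sections P) :
    entry (unitHom P x) y = agree P y ⟨h, x⟩ :=
  entry_singleHom _ _ _ _ _ _ _

theorem unitHom_res (P : Hᵒᵖ ⥤ Type u) {k h : H} (hk : k ≤ h) (x : P.obj (op h)) :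
    unitHom P (res P hk x) = singleMap hk ≫ unitHom P x := by
  refine single_hom_ext_le fun y => ?_
  refine (entry_unitHom P _ y).le.trans (le_trans ?_ (entry_singleMap_comp hk _ y).ge)
  refine le_inf ?_ (agree_le_right P y ⟨k, res P hk x⟩)
  exact (agree_res_le P hk x y).trans (entry_unitHom P x y).ge

/-- The unit of the adjunction. -/
def unitApp (P : Hᵒᵖ ⥤ Type u) : P ⟶ (Theta H).obj ((Delta H).obj P) where
  app h := TypeCat.ofHom fun x => unitHom P (h := h.unop) x
  naturality := by
    intro h k f
    ext x
    exact unitHom_res P (leOfHom f.unop) x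

/-- The value at `a` of a section of `Θ_inf(F)`. -/
def value {F : RelInf H} (a : F.set) (s : Sections ((Theta H).obj F)) : H :=
  entry (F := F) (h := s.1) s.2 a

theorem value_inf_agree_le {F : RelInf H} (a : F.set) (s t : Sections ((Theta H).obj F)) :
    value a s ⊓ agree _ s t ≤ value a t := by
  rw [agree, inf_sSup_eq]
  refine iSup₂_le ?_
  rintro m ⟨hs, ht, e⟩
  have e' := congrArg (fun r : single m ⟶ F => entry r a) e
  erw [entry_singleMap_comp, entry_singleMap_comp] at e'
  exact e'.le.trans inf_le_left

/-- Two sections of `Θ_inf(F)` agree wherever they share a value. -/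
theorem value_inf_value_le {F : RelInf H} (a : F.set) (s t : Sections ((Theta H).obj F)) :
    value a s ⊓ value a t ≤ agree _ s t := by
  obtain ⟨h, s⟩ := s
  obtain ⟨k, t⟩ := t
  change single h ⟶ F at s
  change single k ⟶ F at t
  -- The region of agreement is `s(a) ∧ t(a)` itself: there `s(c)` forces `F(c,a)`, and with `t(a)`
  -- this gives `t(c)`.
  refine le_sSup ⟨inf_le_left.trans (entry_le s a), inf_le_right.trans (entry_le t a), ?_⟩
  refine single_hom_ext_le fun c => ?_
  erw [entry_singleMap_comp, entry_singleMap_comp]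
  refine le_inf (le_trans ?_ (fam_inf_entry_le t c a)) inf_le_right
  rw [← inf_assoc]
  exact inf_le_inf (entry_inf_entry_le s c a) le_rfl

/-- The counit of the adjunction, whose value at `a` and `s : F_h → F` is `s(a)`. -/
def counitApp (F : RelInf H) : (Delta H).obj ((Theta H).obj F) ⟶ F :=
  ofMatrix (F := (Delta H).obj ((Theta H).obj F)) value
    (fun a s t => (inf_le_inf le_rfl (val_fam_Delta _ s t).le).trans (value_inf_agree_le a s t))
    (fun a b _ => fam_inf_entry_le _ a b)
    (fun a s => (entry_le _ a).trans ((val_fam_Delta _ s s).trans (agree_self _ s)).ge)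
    (fun s => ((val_fam_Delta _ s s).trans (agree_self _ s)).le.trans
      (le_iSup_entry (F := F) (h := Sigma.fst s) (Sigma.snd s)))
    (fun a b _ => entry_inf_entry_le _ a b)

theorem val_counitApp (F : RelInf H) (a : F.set) (s : Sections ((Theta H).obj F)) :
    (tr (counitApp F)).val a s = value a s :=
  val_tr_ofMatrix _ _ _ _ _ _ _ _

/-- The term of the composite at the section `s` itself is already `s(a) ∧ h = s(a)`. The naturality
and triangle proofs that follow use the same device, evaluating at the tautological section. -/
theorem unitHom_counitApp (F : RelInf H) {h : H} (s : single h ⟶ F) :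
    unitHom ((Theta H).obj F) (h := h) s ≫ counitApp F = s := by
  refine (single_hom_ext_le fun a => ?_).symm
  let t : Sections ((Theta H).obj F) := ⟨h, s⟩
  refine le_trans (le_inf (val_counitApp F a t).ge ?_) (le_val_tr_comp _ (counitApp F) a t _)
  exact (entry_le s a).trans ((entry_unitHom _ t.2 t).trans (agree_self _ t)).ge

theorem val_Delta_map {P Q : Hᵒᵖ ⥤ Type u} (τ : P ⟶ Q) (b : Sections Q) (a : Sections P) :
    (tr ((Delta H).map τ)).val b a = agree Q b (sigmaMap τ a) :=
  PreTrans.val_ofMatrix _ _ _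

theorem unitHom_map {P Q : Hᵒᵖ ⥤ Type u} (τ : P ⟶ Q) {h : H} (x : P.obj (op h)) :
    unitHom P x ≫ (Delta H).map τ = unitHom Q (τ.app (op h) x) := by
  refine (single_hom_ext_le fun y => ?_).symm
  let z : Sections P := ⟨h, x⟩
  refine (entry_unitHom Q _ y).le.trans (le_trans (le_inf (val_Delta_map τ y z).ge ?_)
    (le_val_tr_comp (unitHom P x) ((Delta H).map τ) y z _))
  exact (agree_le_right Q y _).trans ((entry_unitHom P x z).trans (agree_self P z)).ge

theorem counitApp_naturality {F G : RelInf H} (τ : F ⟶ G) :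
    (Delta H).map ((Theta H).map τ) ≫ counitApp G = counitApp F ≫ τ := by
  refine (hom_ext_le fun b s => ?_).symm
  change Sections ((Theta H).obj F) at s
  let t := sigmaMap ((Theta H).map τ) s
  have e : (tr (counitApp F ≫ τ)).val b s = value b t := by
    refine (val_tr_comp _ _ _ _).trans (Eq.trans ?_ (entry_comp (h := s.1) s.2 τ b).symm)
    exact iSup_congr fun a => congrArg _ (val_counitApp F a s)
  refine e.le.trans (le_trans (le_inf (val_counitApp G b t).ge ?_)
    (le_val_tr_comp ((Delta H).map ((Theta H).map τ)) (counitApp G) b t s))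
  exact (entry_le (F := G) (h := t.1) t.2 b).trans
    ((val_Delta_map _ t s).trans (agree_self _ t)).ge

theorem map_unitApp_counitApp (P : Hᵒᵖ ⥤ Type u) :
    (Delta H).map (unitApp P) ≫ counitApp ((Delta H).obj P) = 𝟙 ((Delta H).obj P) := by
  refine (hom_ext_le fun b a => ?_).symm
  change Sections P at a
  let t := sigmaMap (unitApp P) a
  have e : value (F := (Delta H).obj P) b t = agree P b a := entry_unitHom P a.2 b
  refine (val_fam_Delta P b a).le.trans (le_trans (le_inf ?_ ?_)
    (le_val_tr_comp ((Delta H).map (unitApp P)) (counitApp ((Delta H).obj P)) b t a))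
  · exact e.ge.trans (val_counitApp _ _ t).ge
  · exact (agree_le_right P b a).trans ((val_Delta_map _ t a).trans (agree_self _ t)).ge

variable (H) in
/-- The adjunction `Δ_inf ⊣ Θ_inf`. -/
def deltaThetaAdj : Delta H ⊣ Theta H where
  unit :=
    { app := unitApp
      naturality := fun P Q τ => by
        ext h x
        exact (unitHom_map τ x).symm }
  counit :=
    { app := counitApp
      naturality := fun _ _ τ => counitApp_naturality τ }
  left_triangle_components := map_unitApp_counitApp
  right_triangle_components F := by
    ext h s
    exact unitHom_counitApp F s

/-! ### Invertibility of the counit, and of the unit at `Θ_inf(F)`. -/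

/-- The inverse of the counit: the involution of the counit is again a symmetric map. -/
def counitInv (F : RelInf H) : F ⟶ (Delta H).obj ((Theta H).obj F) :=
  ofMatrix (G := (Delta H).obj ((Theta H).obj F)) (fun s a => value a s)
    (fun s a b => by
      rw [inf_comm, val_fam_comm]
      exact fam_inf_entry_le _ b a)
    (fun s t a => by
      rw [inf_comm, val_fam_comm]
      exact (inf_le_inf le_rfl (val_fam_Delta _ t s).le).trans (value_inf_agree_le a t s))
    (fun s a => entry_le_fam _ a)
    (fun a => by
      -- The column of `a` is a section over its extent whose value at `a` is all of `F(a,a)`; this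
      -- one section proves totality.
      let s : single (F.fam.val a a) ⟶ F := singleHom _ (fun b => F.fam.val b a)
        (fun b => val_fam_le_right F b a) (fun b c => val_fam_trans F b c a)
        (le_iSup (fun b => F.fam.val b a) a)
        (fun b c => by rw [val_fam_comm F c a]; exact val_fam_trans F b a c)
      have hs : F.fam.val a a ≤ entry s a :=
        (entry_singleHom _ (fun b => F.fam.val b a) _ _ _ _ a).ge
      exact le_iSup_of_le (⟨_, s⟩ : Sections ((Theta H).obj F)) hs)
    (fun s t a => (value_inf_value_le a s t).trans (val_fam_Delta _ s t).ge)

theorem val_counitInv (F : RelInf H) (s : Sections ((Theta H).obj F)) (a : F.set) :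
    (tr (counitInv F)).val s a = value a s :=
  val_tr_ofMatrix _ _ _ _ _ _ _ _

instance isIso_counitApp (F : RelInf H) : IsIso (counitApp F) := by
  refine ⟨counitInv F, hom_ext_le fun s t => ?_,
    hom_ext_le fun b a => ?_⟩
  · refine (val_tr_comp _ _ _ _).le.trans ?_
    refine iSup_le fun a => ?_
    refine (inf_le_inf (val_counitInv F s a).le (val_counitApp F a t).le).trans ?_
    exact (value_inf_value_le a s t).trans (val_fam_Delta _ s t).ge
  · refine (val_tr_comp _ _ _ _).le.trans ?_
    refine iSup_le fun (s : Sections ((Theta H).obj F)) => ?_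
    refine (inf_le_inf (val_counitApp F b s).le (val_counitInv F s a).le).trans ?_
    exact entry_inf_entry_le (F := F) (h := s.1) s.2 b a

/-- By a triangle identity this unit is a right-cancellable factor of the identity: it is the
inverse of `Θ_inf` applied to the invertible counit. -/
theorem isIso_unitApp_Theta (F : RelInf H) : IsIso (unitApp ((Theta H).obj F)) := by
  have h : unitApp ((Theta H).obj F) ≫ (Theta H).map (counitApp F) = 𝟙 _ :=
    (deltaThetaAdj H).right_triangle_components F
  rw [← IsIso.eq_comp_inv] at h
  rw [h]
  infer_instance

/-! ### The unit at a sheaf is bijective. -/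

section Sheaf

variable {P : Hᵒᵖ ⥤ Type u}

/-- Keeping `h` as a variable equal to `⋁ A` avoids transporting sections between `P(⋁ A)` and
`P(h)`. -/
theorem IsSheaf.existsUnique {h : H} {A : Set H} (hP : IsSheaf P) (hA : sSup A = h)
    (x : ∀ k : A, P.obj (op (k : H))) (hx : IsMatchingFamily P A x) :
    ∃! y : P.obj (op h), ∀ k : A, res P ((le_sSup k.2).trans hA.le) y = x k := by
  subst hA
  exact hP A x hx

/-- Sections of a sheaf that agree on a cover of `h` are equal. -/
theorem IsSheaf.eq_of_le_agree (hP : IsSheaf P) {h : H} {x y : P.obj (op h)}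
    (hxy : h ≤ agree P ⟨h, x⟩ ⟨h, y⟩) : x = y := by
  let A : Set H := {m | ∃ (hb : m ≤ h) (ha : m ≤ h), res P hb x = res P ha y}
  have hA : sSup A = h := le_antisymm (agree_le_left P ⟨h, x⟩ ⟨h, y⟩) hxy
  have hA' (k : A) : (k : H) ≤ h := k.2.1
  refine (hP.existsUnique hA (fun k => res P (hA' k) x) fun k l => ?_).unique
    (fun k => rfl) fun k => ?_
  · rw [res_res, res_res]
  · obtain ⟨_, _, _, e⟩ := k
    exact e.symm

/-- Transitivity of agreement along `x|_m`, `x`, `y`, `y|_m` reduces this to separatedness over `m`.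
-/
theorem IsSheaf.res_eq_of_le_agree (hP : IsSheaf P) {m : H} {x y : Sections P} (hx : m ≤ x.1)
    (hy : m ≤ y.1) (h : m ≤ agree P x y) : res P hx x.2 = res P hy y.2 := by
  refine hP.eq_of_le_agree ?_
  have hx' := (agree_res P hx x.2).ge
  have hy' := ((agree_comm P _ _).trans (agree_res P hy y.2)).ge
  exact (le_inf (le_inf hx' h) hy').trans
    ((inf_le_inf (agree_trans P _ x y) le_rfl).trans (agree_trans P _ y _))

theorem IsSheaf.unitHom_injective (hP : IsSheaf P) {h : H} {x y : P.obj (op h)}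
    (e : unitHom P x = unitHom P y) : x = y := by
  refine hP.eq_of_le_agree ?_
  rw [← entry_unitHom, ← e, entry_unitHom, agree_self]

theorem IsSheaf.unitHom_surjective (hP : IsSheaf P) {h : H} (s : single h ⟶ (Delta H).obj P) :
    ∃ x : P.obj (op h), unitHom P x = s := by
  have single (y z : Sections P) : entry s y ⊓ entry s z ≤ agree P y z :=
    (entry_inf_entry_le s y z).trans (val_fam_Delta P y z).le
  have le_fst (y : Sections P) : entry s y ≤ y.1 :=
    (le_inf le_rfl le_rfl).trans ((single y y).trans (agree_self P y).le)
  have le_res (y : Sections P) :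
      entry s y ≤ entry s (⟨entry s y, res P (le_fst y) y.2⟩ : Sections P) := by
    refine le_trans (le_inf ?_ le_rfl) (fam_inf_entry_le s _ y)
    exact (agree_res P (le_fst y) y.2).ge.trans (val_fam_Delta P _ y).ge
  -- The sheaf condition is indexed by subsets of `H`, so one section is kept for each level `m`.
  -- Any choice works, since single-valuedness of `s` makes all candidates match.
  let A : Set H := {m | ∃ x : P.obj (op m), m ≤ entry s (⟨m, x⟩ : Sections P)}
  have mem (y : Sections P) : entry s y ∈ A := ⟨res P (le_fst y) y.2, le_res y⟩
  have hA : sSup A = h := by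
    refine le_antisymm (sSup_le fun m ⟨x, hm⟩ => hm.trans (entry_le s _)) ?_
    exact (le_iSup_entry s).trans (iSup_le fun y => le_sSup (mem y))
  choose x hx using fun k : A => k.2
  obtain ⟨z, hz, -⟩ := hP.existsUnique hA x fun k l =>
    hP.res_eq_of_le_agree (x := ⟨k, x k⟩) (y := ⟨l, x l⟩) inf_le_left inf_le_right
      ((inf_le_inf (hx k) (hx l)).trans (single _ _))
  refine ⟨z, (single_hom_ext_le fun (y : Sections P) => ?_).symm⟩
  -- The section chosen over `s(y)` need not be the restriction of `y`, but both carry weight at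
  -- least `s(y)`, so they agree on `s(y)`.
  have e := hz ⟨_, mem y⟩
  rw [entry_unitHom]
  refine le_trans ?_ (agree_res_le P (entry_le s y) z y)
  rw [e]
  exact (le_inf le_rfl (hx ⟨_, mem y⟩)).trans (single _ _)

theorem IsSheaf.isIso_unitApp (hP : IsSheaf P) : IsIso (unitApp P) := by
  rw [NatTrans.isIso_iff_isIso_app]
  intro h
  rw [isIso_iff_bijective]
  exact ⟨fun _ _ e => hP.unitHom_injective e, fun s => hP.unitHom_surjective s⟩

end Sheaf

/-! ### The equivalence. -/

variable (H) in
/-- The equivalence between sheaves and relational-sheaves. -/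
noncomputable def sheafEquivalence : SHV H ≌ RelInf H :=
  haveI (P : SHV H) : IsIso ((deltaThetaAdj H).unit.app P.obj) := IsSheaf.isIso_unitApp P.property
  haveI (F : RelInf H) : IsIso ((deltaThetaAdj H).counit.app F) := isIso_counitApp F
  CategoryTheory.Equivalence.mk (IsSheaf.ι ⋙ Delta H) (IsSheaf.lift (Theta H) isSheaf_Theta)
    (NatIso.ofComponents
      (fun P => IsSheaf.isoMk (asIso ((deltaThetaAdj H).unit.app P.obj)))
      (fun {P Q} f => by
        ext1
        exact (deltaThetaAdj H).unit.naturality f.hom))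
    (NatIso.ofComponents (fun F => asIso ((deltaThetaAdj H).counit.app F))
      (fun τ => (deltaThetaAdj H).counit.naturality τ))

end RelSheaf

theorem mainTheorem1 (H : Type u) [Order.Frame H] :
    ∃ adj : RelSheaf.Delta H ⊣ RelSheaf.Theta H,
      -- the unit sends `x ∈ P(h)` to the representable singleton morphism of `x`
      (∀ (P : Hᵒᵖ ⥤ Type u) (h : H) (x : P.obj (op h)) (l : H) (y : Σ k : H, P.obj (op k)),
        (RelSheaf.RelInf.tr ((adj.unit.app P).app (op h) x)).rel l y PUnit.unit ↔
          ((RelSheaf.Delta H).obj P).fam.rel l y ⟨h, x⟩) ∧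
      (∀ F : RelSheaf.RelInf H, IsIso (adj.unit.app ((RelSheaf.Theta H).obj F))) ∧
      ∃ (hΘ : ∀ F : RelSheaf.RelInf H, RelSheaf.IsSheaf ((RelSheaf.Theta H).obj F))
        (e : RelSheaf.SHV H ≌ RelSheaf.RelInf H),
        e.functor = RelSheaf.IsSheaf.ι ⋙ RelSheaf.Delta H ∧
        e.inverse = RelSheaf.IsSheaf.lift (RelSheaf.Theta H) hΘ :=
  -- In the unit formula both relations unfold to `l ≤ agree P y ⟨h, x⟩`.
  ⟨RelSheaf.deltaThetaAdj H, fun _ _ _ _ _ => Iff.rfl, RelSheaf.isIso_unitApp_Theta,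
    RelSheaf.isSheaf_Theta, RelSheaf.sheafEquivalence H, rfl, rfl⟩
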